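/- Let $m,k$ be positive integers with $m$ odd and $\gcd(k,m)=1$, and let $\alpha,\beta\in\mathbb{F}_{2^m}\setminus\mathbb{F}_2$ satisfy $\alpha^2+\beta^2+\alpha\beta+1=0$. For $x,y\in\mathbb{F}_{2^m}$ put $R(x,y)=(x+\alpha y)^{2^k+1}+(\beta y)^{2^k+1}$. Then $x\mapsto R(x,y)$ is a permutation of $\mathbb{F}_{2^m}$ for every $y\in\mathbb{F}_{2^m}$, and the closed butterfly $V_R(x,y)=(R(x,y),R(y,x))$ is a permutation of $V=\mathbb{F}_{2^m}\times\mathbb{F}_{2^m}$ whose boomerang uniformity $$\max_{a,b\in V\setminus\{0\}}\#\{v\in V: V_R^{-1}(V_R(v)+b)+V_R^{-1}(V_R(v+a)+b)=a\}$$ is exactly $4$. Moreover, its differential uniformity $$\max_{a\in V\setminus\{0\},\ b\in V}\#\{v\in V: V_R(v)+V_R(v+a)=b\}$$ is exactly $4$. -/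

import Mathlib

/-- The entry `DDT_F(a, b) = #{x | F(x) + F(x + a) = b}` of the difference distribution table.
(It is used for spaces of characteristic two, where `+` and `-` agree.) -/
noncomputable def ddt {V : Type*} [AddCommGroup V] (F : V → V) (a b : V) : ℕ :=
  Nat.card {x : V // F x + F (x + a) = b}

open Classical in
/-- The differential uniformity: the maximum of `DDT_F(a, b)` over `a ≠ 0` and all `b`. -/
noncomputable def differentialUniformity {V : Type*} [AddCommGroup V] [Fintype V]
    (F : V → V) : ℕ :=
  (Finset.univ.filter fun p : V × V => p.1 ≠ 0).sup fun p => ddt F p.1 p.2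

/-- The entry `BCT_F(a, b) = #{x | F⁻¹(F(x) + b) + F⁻¹(F(x + a) + b) = a}` of the boomerang
connectivity table of a permutation `F`. -/
noncomputable def bct {V : Type*} [AddCommGroup V] (F : Equiv.Perm V) (a b : V) : ℕ :=
  Nat.card {x : V // F.symm (F x + b) + F.symm (F (x + a) + b) = a}

open Classical in
/-- The boomerang uniformity: the maximum of `BCT_F(a, b)` over `a ≠ 0` and `b ≠ 0`. -/
noncomputable def boomerangUniformity {V : Type*} [AddCommGroup V] [Fintype V]
    (F : Equiv.Perm V) : ℕ :=
  (Finset.univ.filter fun p : V × V => p.1 ≠ 0 ∧ p.2 ≠ 0).sup fun p => bct F p.1 p.2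

/-- The bivariate polynomial function `R(x, y) = (x + αy)^(2^k+1) + (βy)^(2^k+1)`. -/
def butterflyR {K : Type*} [Field K] (k : ℕ) (α β : K) (x y : K) : K :=
  (x + α * y) ^ (2 ^ k + 1) + (β * y) ^ (2 ^ k + 1)

/-- The closed butterfly `V_R(x, y) = (R(x, y), R(y, x))`. -/
def closedButterfly {K : Type*} (R : K → K → K) (p : K × K) : K × K :=
  (R p.1 p.2, R p.2 p.1)

/-! Since `m` is odd, `ω ^ 2 = 1 + ω` has no root in `K`, so `L = K[ω]` is a field. Let `σ` be the
`2 ^ k`-power map and `φ` its extension to `L` fixing `ω`. Up to additive isomorphisms on both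
sides, the butterfly is the Gold-type map `z ↦ z * φ z` on `L` (`closedButterfly_eq_comp`), and both
uniformities are preserved. As `φ^[m] = id` with `m` odd, this map is a permutation, and each
uniformity equals the number of fixed points of `φ`: these form `F₂[ω]`, of size 4. -/

section Uniformity

variable {V W : Type*} [AddCommGroup V] [AddCommGroup W]

theorem ddt_trans (e : V ≃+ W) (G : W → W) (e' : W ≃+ V) (a b : V) :
    ddt (fun v => e' (G (e v))) a b = ddt G (e a) (e'.symm b) := by
  refine Nat.card_congr (e.toEquiv.subtypeEquiv fun v => ?_)
  simp [← map_add, AddEquiv.eq_symm_apply]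

theorem bct_trans (e : V ≃+ W) (G : Equiv.Perm W) (e' : W ≃+ V) (a b : V) :
    bct ((e.toEquiv.trans G).trans e'.toEquiv) a b = bct G (e a) (e'.symm b) := by
  refine Nat.card_congr (e.toEquiv.subtypeEquiv fun v => ?_)
  simp [← map_add, AddEquiv.symm_apply_eq]
  simp

theorem differentialUniformity_eq [Fintype V] {F : V → V} {n : ℕ}
    (hle : ∀ a b, a ≠ 0 → ddt F a b ≤ n) {a b : V} (ha : a ≠ 0) (hge : n ≤ ddt F a b) :
    differentialUniformity F = n := by
  classical
  refine le_antisymm (Finset.sup_le fun p hp => hle _ _ (by simpa using hp)) (hge.trans ?_)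
  exact Finset.le_sup (f := fun p : V × V => ddt F p.1 p.2) (b := (a, b)) (by simpa using ha)

theorem boomerangUniformity_eq [Fintype V] {F : Equiv.Perm V} {n : ℕ}
    (hle : ∀ a b, a ≠ 0 → b ≠ 0 → bct F a b ≤ n) {a b : V} (ha : a ≠ 0) (hb : b ≠ 0)
    (hge : n ≤ bct F a b) : boomerangUniformity F = n := by
  classical
  refine le_antisymm (Finset.sup_le fun p hp => ?_) (hge.trans ?_)
  · have hp' : p.1 ≠ 0 ∧ p.2 ≠ 0 := by simpa using hp
    exact hle _ _ hp'.1 hp'.2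
  · exact Finset.le_sup (f := fun p : V × V => bct F p.1 p.2) (b := (a, b)) (by simpa using ⟨ha, hb⟩)

end Uniformity

/-! ### Gold-type maps `z ↦ z * φ z` in characteristic two. -/

section Gold

variable {L : Type*} [Field L] (φ : L →+* L) {m : ℕ}

theorem map_eq_of_map_map_eq (hm : Odd m) (hφ : ∀ z, φ^[m] z = z) {z : L}
    (hz : φ (φ z) = z) : φ z = z := by
  have h2 : Function.IsPeriodicPt φ 2 z := hz
  have hmz : Function.IsPeriodicPt φ m z := hφ z
  have h := h2.gcd hmz
  rwa [(Nat.coprime_two_left.2 hm).gcd_eq_one] at h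

/-- Fixing one solution `y`, the map `x ↦ (x + y) / a` embeds the solutions into the fixed points of
`φ`. -/
theorem natCard_le_of_map_div_eq [Finite L] {a : L} (ha : a ≠ 0) {p : L → Prop}
    (hp : ∀ x y, p x → p y → φ ((x + y) / a) = (x + y) / a) :
    Nat.card {x // p x} ≤ Nat.card {z // φ z = z} := by
  rcases isEmpty_or_nonempty {x // p x} with h | ⟨⟨y, hy⟩⟩
  · simp
  refine Nat.card_le_card_of_injective
    (fun x => ⟨(x.1 + y) / a, hp _ _ x.2 hy⟩) fun x x' h => ?_
  have h' : (x.1 + y) / a = (x'.1 + y) / a := congrArg Subtype.val h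
  exact Subtype.ext (add_right_cancel ((div_left_inj' ha).1 h'))

theorem natCard_fixed_le [Finite L] {p : L → Prop} (hp : ∀ x, φ x = x → p x) :
    Nat.card {z // φ z = z} ≤ Nat.card {x // p x} :=
  Nat.card_le_card_of_injective (Subtype.map id hp) (Subtype.map_injective _ Function.injective_id)

variable [CharP L 2]

/-- A trace argument: iterating `φ z = z + c` an odd number `m` of times returns `z = z + c`. -/
theorem eq_zero_of_add_map_eq (hm : Odd m) (hφ : ∀ z, φ^[m] z = z) {z c : L}
    (hz : z + φ z = c) (hc : φ c = c) : c = 0 := by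
  have h (n : ℕ) : φ^[n] z = z + n * c := by
    induction n with
    | zero => simp
    | succ n ih =>
      have hz' : φ z = z + c := by rw [← hz, CharTwo.add_cancel_left]
      rw [Function.iterate_succ_apply', ih]
      simp only [map_add, map_mul, map_natCast, hc, hz']
      push_cast
      ring
  have hm1 : (m : L) = 1 := by
    rw [CharTwo.natCast_eq_ite, if_neg (Nat.not_even_iff_odd.2 hm)]
  simpa [hφ, hm1] using h m

theorem mul_map_injective (hm : Odd m) (hφ : ∀ z, φ^[m] z = z) :
    Function.Injective fun z => z * φ z := by
  intro z w h
  simp only at h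
  rcases eq_or_ne w 0 with rfl | hw
  · simpa using h
  have hw' : φ w ≠ 0 := by simpa using hw
  -- The ratio satisfies `u * φ u = 1`, so `φ (φ u) = u`; odd `m` forces `φ u = u`, hence `u ^ 2 =
  -- 1`.
  set u := z / w with hu
  have hzu : z = u * w := by rw [hu, div_mul_cancel₀ _ hw]
  have h1 : u * φ u = 1 := by
    rw [hu, map_div₀]
    field_simp
    exact h
  have hu0 : φ u ≠ 0 := right_ne_zero_of_mul_eq_one h1
  have h2 : φ (φ u) = u := by
    have := congrArg φ h1
    rw [map_mul, map_one] at this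
    apply mul_left_cancel₀ hu0
    rw [this, mul_comm, h1]
  rw [map_eq_of_map_map_eq φ hm hφ h2] at h1
  have : u = 1 := by
    apply CharTwo.sq_injective
    simpa [sq] using h1
  rw [hzu, this, one_mul]

theorem map_div_eq_iff {x a : L} (ha : a ≠ 0) : φ (x / a) = x / a ↔ x * φ a + a * φ x = 0 := by
  have ha' : φ a ≠ 0 := by simpa using ha
  rw [map_div₀, div_eq_div_iff ha' ha, CharTwo.add_eq_zero, mul_comm a, eq_comm]

theorem mul_map_add (x a : L) :
    x * φ x + (x + a) * φ (x + a) = x * φ a + a * φ x + a * φ a := by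
  linear_combination (norm := (rw [map_add]; ring_nf)) (x * φ x) * CharTwo.two_eq_zero (R := L)

theorem ddt_mul_map_le [Finite L] {a b : L} (ha : a ≠ 0) :
    ddt (fun z => z * φ z) a b ≤ Nat.card {z // φ z = z} := by
  refine natCard_le_of_map_div_eq φ ha fun x y hx hy => ?_
  simp only [mul_map_add] at hx hy
  rw [map_div_eq_iff φ ha]
  have := CharTwo.two_eq_zero (R := L)
  rw [map_add]
  linear_combination hx + hy + (b - a * φ a) * this

theorem le_ddt_mul_map [Finite L] : Nat.card {z // φ z = z} ≤ ddt (fun z => z * φ z) 1 1 := by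
  refine natCard_fixed_le φ fun x hx => ?_
  rw [mul_map_add, map_one, hx, mul_one, one_mul, CharTwo.add_self_eq_zero, zero_add, mul_one]

theorem le_bct_mul_map [Finite L] {G : Equiv.Perm L} (hG : ∀ z, G z = z * φ z) :
    Nat.card {z // φ z = z} ≤ bct G 1 1 := by
  refine natCard_fixed_le φ fun x hx => ?_
  have h : G x + 1 = G (x + 1) := by
    rw [hG, hG, map_add, map_one, hx, CharTwo.add_mul_self, one_mul]
  rw [← h, CharTwo.add_cancel_right, h, G.symm_apply_apply, G.symm_apply_apply, add_right_comm,
    CharTwo.add_self_eq_zero, zero_add]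

/-- With `c` the shift from `x` to `G.symm (G x + b)`, the boomerang condition says that `G` has
derivative `b` in direction `c` at both `x` and `x + a`. Comparing the two makes `f = c / a` fixed
by `φ`. -/
theorem exists_fixed_of_boomerang {G : Equiv.Perm L} (hG : ∀ z, G z = z * φ z) {a b x : L}
    (ha : a ≠ 0) (hb : b ≠ 0) (hx : G.symm (G x + b) + G.symm (G (x + a) + b) = a) :
    ∃ f, f ≠ 0 ∧ φ f = f ∧ f * (x / a) + φ (f * (x / a)) = b / (a * φ a) + f ^ 2 := by
  have h2 := CharTwo.two_eq_zero (R := L)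
  have ha' : φ a ≠ 0 := by simpa using ha
  obtain ⟨c, hc⟩ : ∃ c, x + c = G.symm (G x + b) := ⟨_, CharTwo.add_cancel_left _ _⟩
  have hca : G.symm (G (x + a) + b) = x + a + c := by
    rw [← hc] at hx
    linear_combination hx - (x + c) * h2
  have h1 : G (x + c) = G x + b := by rw [hc, G.apply_symm_apply]
  have h3 : G (x + a + c) = G (x + a) + b := by rw [← hca, G.apply_symm_apply]
  have e1 := mul_map_add φ x c
  have e2 := mul_map_add φ (x + a) c
  rw [← hG x, ← hG (x + c), h1, CharTwo.add_cancel_left] at e1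
  rw [← hG (x + a), ← hG (x + a + c), h3, CharTwo.add_cancel_left] at e2
  have hc0 : c ≠ 0 := by
    rintro rfl
    simp at e1
    exact hb e1
  have hf : φ (c / a) = c / a := by
    rw [map_div_eq_iff φ ha]
    rw [map_add] at e2
    linear_combination e1 - e2
  refine ⟨c / a, div_ne_zero hc0 ha, hf, ?_⟩
  rw [map_mul, hf, map_div₀]
  have hφc : φ c = c / a * φ a := by
    rw [← hf, map_div₀, div_mul_cancel₀ _ ha']
  rw [e1, hφc]
  field_simp
  linear_combination -(φ a * c) * h2

theorem bct_mul_map_le [Finite L] (hm : Odd m) (hφ : ∀ z, φ^[m] z = z) {G : Equiv.Perm L}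
    (hG : ∀ z, G z = z * φ z) {a b : L} (ha : a ≠ 0) (hb : b ≠ 0) :
    bct G a b ≤ Nat.card {z // φ z = z} := by
  refine natCard_le_of_map_div_eq φ ha fun x y hx hy => ?_
  have h2 := CharTwo.two_eq_zero (R := L)
  obtain ⟨f, hf0, hf, hfx⟩ := exists_fixed_of_boomerang φ hG ha hb hx
  obtain ⟨g, -, hg, hgy⟩ := exists_fixed_of_boomerang φ hG ha hb hy
  -- Adding the two equations cancels `b`, and the trace argument applies to the fixed element `f ^
  -- 2 + g ^ 2`.
  have hfg : f ^ 2 + g ^ 2 = 0 := by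
    refine eq_zero_of_add_map_eq φ hm hφ (z := f * (x / a) + g * (y / a)) ?_ (by simp [hf, hg])
    rw [map_add]
    linear_combination hfx + hgy + b / (a * φ a) * h2
  obtain rfl : f = g := CharTwo.sq_injective (CharTwo.add_eq_zero.1 hfg)
  rw [map_mul, hf] at hfx hgy
  apply mul_left_cancel₀ hf0
  rw [add_div, map_add]
  linear_combination hfx - hgy + (f * φ (y / a) - f * (x / a)) * h2

end Gold

/-! ### The quadratic extension and the butterfly. -/

section QuadraticExtension

open QuadraticAlgebra

variable {K : Type*} [Field K]

/-- The extension of a ring endomorphism `σ` of `K` to `K[ω]`, `ω ^ 2 = 1 + ω`, fixing `ω`. -/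
def quadraticMap (σ : K →+* K) : QuadraticAlgebra K 1 1 →+* QuadraticAlgebra K 1 1 where
  toFun z := ⟨σ z.re, σ z.im⟩
  map_one' := by ext <;> simp
  map_zero' := by ext <;> simp
  map_mul' z w := by ext <;> simp
  map_add' z w := by ext <;> simp

theorem quadraticMap_apply (σ : K →+* K) (z : QuadraticAlgebra K 1 1) :
    quadraticMap σ z = ⟨σ z.re, σ z.im⟩ := rfl

theorem quadraticMap_iterate {σ : K →+* K} {m : ℕ} (hσ : ∀ x, σ^[m] x = x)
    (z : QuadraticAlgebra K 1 1) : (quadraticMap σ)^[m] z = z := by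
  have h (n : ℕ) : (quadraticMap σ)^[n] z = ⟨σ^[n] z.re, σ^[n] z.im⟩ := by
    induction n with
    | zero => rfl
    | succ n ih => rw [Function.iterate_succ_apply', ih, quadraticMap_apply,
        Function.iterate_succ_apply', Function.iterate_succ_apply']
  rw [h, hσ, hσ]

theorem natCard_quadraticMap_fixed {σ : K →+* K} (hσ : ∀ x, σ x = x → x = 0 ∨ x = 1) :
    Nat.card {z // quadraticMap σ z = z} = 4 := by
  have hfix (x : K) : σ x = x ↔ x ∈ ({0, 1} : Set K) :=
    ⟨hσ x, by rintro (rfl | rfl) <;> simp⟩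
  have e : {z // quadraticMap σ z = z} ≃ ({0, 1} : Set K) × ({0, 1} : Set K) :=
    ((equivProd (1 : K) 1).subtypeEquiv fun z => by
      rw [quadraticMap_apply, QuadraticAlgebra.ext_iff, hfix, hfix]; rfl).trans
      (Equiv.Set.prod ({0, 1} : Set K) ({0, 1} : Set K))
  rw [Nat.card_congr e, Nat.card_prod, Nat.card_coe_set_eq, Set.ncard_pair zero_ne_one]

/-- The additive isomorphism `(x, y) ↦ (x + α * y) + β * y * ω`. -/
def toQuadratic (α : K) {β : K} (hβ : β ≠ 0) : K × K ≃+ QuadraticAlgebra K 1 1 where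
  toFun p := ⟨p.1 + α * p.2, β * p.2⟩
  invFun z := (z.re - α * (z.im / β), z.im / β)
  left_inv p := by ext <;> simp <;> field_simp <;> ring
  right_inv z := by ext <;> simp <;> field_simp
  map_add' p q := by ext <;> simp <;> ring

/-- The additive isomorphism `u + v * ω ↦ (u, c * u + s * v)`. -/
def ofQuadratic (c : K) {s : K} (hs : s ≠ 0) : QuadraticAlgebra K 1 1 ≃+ K × K where
  toFun z := (z.re, c * z.re + s * z.im)
  invFun p := ⟨p.1, (p.2 - c * p.1) / s⟩
  left_inv z := by ext <;> simp <;> field_simp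
  right_inv p := by ext <;> simp; field_simp; ring
  map_add' p q := by ext <;> simp <;> ring

/-- The real part of the product is `R(x, y)`. The relation between `α` and `β`, together with its
image under `σ`, makes `R(y, x)` a combination of the real and `ω` parts. -/
theorem closedButterfly_eq_comp [CharP K 2] (σ : K →+* K) {α β : K}
    (hαβ : α ^ 2 + β ^ 2 + α * β + 1 = 0) (hβ : β ≠ 0)
    (hs : α * σ α + (α * σ β + β * σ α) ≠ 0) (p : K × K) :
    closedButterfly (fun x y => (x + α * y) * σ (x + α * y) + β * y * σ (β * y)) p =
      ofQuadratic (α * σ α + β * σ β) hs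
        (toQuadratic α hβ p * quadraticMap σ (toQuadratic α hβ p)) := by
  obtain ⟨x, y⟩ := p
  have h2 := CharTwo.two_eq_zero (R := K)
  have hσ : σ α ^ 2 + σ β ^ 2 + σ α * σ β + 1 = 0 := by
    simpa using congrArg σ hαβ
  ext
  · simp [closedButterfly, ofQuadratic, toQuadratic, quadraticMap_apply]
  · simp [closedButterfly, ofQuadratic, toQuadratic, quadraticMap_apply]
    generalize σ α = α' at *
    generalize σ β = β' at *
    generalize σ x = x' at *
    generalize σ y = y' at *
    grind

end QuadraticExtension

theorem eq_zero_or_one_of_iterateFrobenius_eq {K : Type*} [Field K] [Fintype K] [CharP K 2]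
    {m k : ℕ} (hkm : Nat.gcd k m = 1) (hK : Fintype.card K = 2 ^ m) {x : K}
    (hx : iterateFrobenius K 2 k x = x) : x = 0 ∨ x = 1 := by
  have hk : Function.IsPeriodicPt (frobenius K 2) k x := by
    rwa [Function.IsPeriodicPt, Function.IsFixedPt, iterate_frobenius]
  have hm : Function.IsPeriodicPt (frobenius K 2) m x := by
    rw [Function.IsPeriodicPt, Function.IsFixedPt, iterate_frobenius, ← hK, FiniteField.pow_card]
  have h := hk.gcd hm
  rw [hkm] at h
  have h' : x ^ 2 = x := h
  rwa [sq, mul_left_eq_self₀, or_comm] at h'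

theorem theorem1 {K : Type*} [Field K] [Fintype K] (m k : ℕ) (hm : Odd m) (hk : 0 < k)
    (hkm : Nat.gcd k m = 1) (hK : Fintype.card K = 2 ^ m) (α β : K)
    (hα : α ∉ ({0, 1} : Set K)) (hβ : β ∉ ({0, 1} : Set K))
    (hαβ : α ^ 2 + β ^ 2 + α * β + 1 = 0) :
    (∀ y : K, Function.Bijective fun x : K => butterflyR k α β x y) ∧
    ∃ hV : Function.Bijective (closedButterfly (butterflyR k α β)),
      boomerangUniformity (Equiv.ofBijective (closedButterfly (butterflyR k α β)) hV) = 4 ∧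
      differentialUniformity (closedButterfly (butterflyR k α β)) = 4 := by
  have : CharP K 2 := charP_of_card_eq_prime_pow hK
  have h2 := CharTwo.two_eq_zero (R := K)
  have hα0 : α ≠ 0 := fun h => hα (by simp [h])
  have hβ0 : β ≠ 0 := fun h => hβ (by simp [h])
  set σ := iterateFrobenius K 2 k with hσdef
  have hσm (x : K) : σ^[m] x = x := by
    rw [hσdef, ← iterateFrobenius_mul_apply, iterateFrobenius_def, mul_comm, pow_mul, ← hK,
      FiniteField.pow_card_pow]
  have hfix (x : K) (hx : σ x = x) : x = 0 ∨ x = 1 :=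
    eq_zero_or_one_of_iterateFrobenius_eq hkm hK hx
  have hR : butterflyR k α β =
      fun x y => (x + α * y) * σ (x + α * y) + β * y * σ (β * y) := by
    funext x y
    simp only [butterflyR, hσdef, iterateFrobenius_def, pow_succ']
  -- This makes `K[ω]` a field: a root would satisfy `r + r ^ 2 = 1`, against the trace argument for
  -- Frobenius.
  have : Fact (∀ r : K, r ^ 2 ≠ 1 + 1 * r) := ⟨fun r hr => by
    refine one_ne_zero (eq_zero_of_add_map_eq (frobenius K 2) hm (fun z => ?_) (z := r) ?_
      (map_one _))
    · rw [iterate_frobenius, ← hK, FiniteField.pow_card]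
    · rw [frobenius_def, hr, one_mul]
      linear_combination r * h2⟩
  -- Otherwise, dividing by `α * σ α` gives `z + σ z = 1` for `z = β / α`.
  have hs : α * σ α + (α * σ β + β * σ α) ≠ 0 := by
    intro h
    have hα' : σ α ≠ 0 := by simpa using hα0
    refine one_ne_zero (eq_zero_of_add_map_eq σ hm hσm (z := β / α) ?_ (map_one σ))
    rw [map_div₀]
    field_simp
    linear_combination h - α * σ α * h2
  have : CharP (QuadraticAlgebra K 1 1) 2 :=
    CharTwo.of_one_ne_zero_of_two_eq_zero one_ne_zero (by rw [← one_add_one_eq_two]; ext <;> simp [CharTwo.add_self_eq_zero])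
  have : Finite (QuadraticAlgebra K 1 1) := Finite.of_equiv _ (QuadraticAlgebra.equivProd 1 1).symm
  set φ := quadraticMap σ
  have hφm := quadraticMap_iterate hσm
  have hcard : Nat.card {z // φ z = z} = 4 := natCard_quadraticMap_fixed hfix
  let G : Equiv.Perm (QuadraticAlgebra K 1 1) :=
    Equiv.ofBijective _ (Finite.injective_iff_bijective.1 (mul_map_injective φ hm hφm))
  have hG (z) : G z = z * φ z := rfl
  set e := toQuadratic α hβ0
  set e' := ofQuadratic (α * σ α + β * σ β) hs
  have hcomp : closedButterfly (butterflyR k α β) = (e.toEquiv.trans G).trans e'.toEquiv := by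
    funext p
    rw [hR]
    exact closedButterfly_eq_comp σ hαβ hβ0 hs p
  have he1 : e (e.symm 1) = 1 := e.apply_symm_apply 1
  have he1' : e'.symm (e' 1) = 1 := e'.symm_apply_apply 1
  refine ⟨fun y => ?_, hcomp ▸ Equiv.bijective _, ?_, ?_⟩
  · rw [hR]
    exact Finite.injective_iff_bijective.1 fun x x' h => add_right_cancel
      (mul_map_injective σ hm hσm (add_right_cancel h))
  · have : Equiv.ofBijective _ (hcomp ▸ Equiv.bijective _) =
      (e.toEquiv.trans G).trans e'.toEquiv := Equiv.ext fun p => congrFun hcomp p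
    rw [this]
    -- The pair corresponds to `(1, 1)` for `G`, where every fixed point of `φ` is a solution.
    refine boomerangUniformity_eq (fun a b ha hb => ?_) (a := e.symm 1) (b := e' 1)
      (by simp) (by simp) ?_
    · rw [bct_trans, ← hcard]
      exact bct_mul_map_le φ hm hφm hG (by simpa using ha) (by simpa using hb)
    · rw [bct_trans, ← hcard, he1, he1']
      exact le_bct_mul_map φ hG
  · rw [hcomp]
    refine differentialUniformity_eq (fun a b ha => ?_) (a := e.symm 1) (b := e' 1) (by simp) ?_
    · rw [← hcard]
      exact (ddt_trans e G e' a b).trans_le (ddt_mul_map_le φ (by simpa using ha))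
    · rw [← hcard]
      refine le_trans ?_ (ddt_trans e G e' _ _).ge
      rw [he1, he1']
      exact le_ddt_mul_map φ
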